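/- Let $\phi_G(x)=\frac{1}{\sqrt{2\pi}}e^{-x^2/2}$. For a probability density $f$ on $\mathbb{R}$ and $n\ge 2$, let $\mathbb{P}_f$ be the law of an i.i.d. sample $X_1,\dots,X_n$ with common density $f$, and let $X_{(1)}\le\dots\le X_{(n)}$ be its order statistics. Put $\mathcal{K}_n=\{2^j : 0\le j\le\lfloor\log_2(n/2)\rfloor\}$. For $u\in(0,1)$ and $k\in\mathcal{K}_n$ let $q_{u,k}$ be the $(1-u)$-quantile of $X_{(n-k+1)}-X_{(k)}$ under the null hypothesis $f\in\mathcal{F}_0=\{\phi_G(\cdot-\mu):\mu\in\mathbb{R}\}$, that is, $q_{u,k}=\inf\{t\in\mathbb{R}:\mathbb{P}_{\phi_G}(X_{(n-k+1)}-X_{(k)}\le t)\ge 1-u\}$ (the law of this spacing is the same for every $\mu$). For $\alpha\in(0,1)$ let $$\alpha_n=\sup\{u\in(0,1):\mathbb{P}_{\phi_G}(\exists k\in\mathcal{K}_n,\ X_{(n-k+1)}-X_{(k)}>q_{u,k})\le\alpha\},\qquad \Psi_\alpha=\sup_{k\in\mathcal{K}_n}\mathbf{1}_{\{X_{(n-k+1)}-X_{(k)}>q_{\alpha_n,k}\}}.$$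 **Theorem.** Let $\alpha,\beta\in(0,1)$, $\frac12<\delta<1$ and $0<r<1$, and assume $r>r^*(\delta)$, where $$r^*(\delta)=\begin{cases}\delta-\frac12 & \text{if } \frac12<\delta<\frac34,\\ (1-\sqrt{1-\delta})^2 & \text{if } \frac34\le\delta<1.\end{cases}$$ Let $(\varepsilon_n)$, $(\mu_{1,n})$, $(\mu_{2,n})$ be real sequences such that $\varepsilon_n/n^{-\delta}\to1$ and $(\mu_{2,n}-\mu_{1,n})/\sqrt{2r\log n}\to1$ as $n\to\infty$ (so $0<\varepsilon_n<1$ and $\mu_{1,n}<\mu_{2,n}$ for all large $n$), and set $f_n=(1-\varepsilon_n)\phi_G(\cdot-\mu_{1,n})+\varepsilon_n\phi_G(\cdot-\mu_{2,n})$. Then: 1. for every $n\ge2$, $\Psi_\alpha$ is a level-$\alpha$ test of the null hypothesis with unknown mean: it is a measurable $\{0,1\}$-valued function of the sample and $\mathbb{P}_{\phi_G(\cdot-\mu)}(\Psi_\alpha=1)\le\alpha$ for every $\mu\in\mathbb{R}$; 2. there is $n_0$ such that $\mathbb{P}_{f_n}(\Psi_\alpha=0)\le\beta$ for all $n\ge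 n_0$. -/

import Mathlib

open MeasureTheory ProbabilityTheory Filter Topology

noncomputable section

/-- The law `ℙ_f` of an i.i.d. sample `(X₁, …, Xₙ)` with common density `f` with respect to the
Lebesgue measure on `ℝ`. -/
def sampleLaw (n : ℕ) (f : ℝ → ℝ) : Measure (Fin n → ℝ) :=
  Measure.pi fun _ => volume.withDensity fun x => ENNReal.ofReal (f x)

/-- The two-component mixture density `(1 - ε) φ(· - μ₁) + ε φ(· - μ₂)`. -/
def mixtureDensity (φ : ℝ → ℝ) (ε μ₁ μ₂ : ℝ) (x : ℝ) : ℝ :=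
  (1 - ε) * φ (x - μ₁) + ε * φ (x - μ₂)

/-- The order statistic `X_(k)`, for `1 ≤ k ≤ n`: the `k`-th term of the sample sorted in
nondecreasing order (and `0` when `k - 1 ≥ n`). -/
def orderStat {n : ℕ} (x : Fin n → ℝ) (k : ℕ) : ℝ :=
  if h : k - 1 < n then x (Tuple.sort x ⟨k - 1, h⟩) else 0

/-- The spacing `X_(n-k+1) - X_(k)`. -/
def spacing {n : ℕ} (x : Fin n → ℝ) (k : ℕ) : ℝ :=
  orderStat x (n - k + 1) - orderStat x k

/-- The set `𝒦ₙ = {2 ^ j : 0 ≤ j ≤ ⌊log₂ (n / 2)⌋}`, for `n ≥ 2`. -/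
def indexSet (n : ℕ) : Finset ℕ :=
  (Finset.range (Nat.log 2 (n / 2) + 1)).image fun j => 2 ^ j

/-- `q_{u,k}`: the `(1 - u)`-quantile of `X_(n-k+1) - X_(k)` under the null hypothesis. The law
of this spacing does not depend on the location parameter, so it is taken under the density `φ`. -/
def nullQuantile (φ : ℝ → ℝ) (n : ℕ) (u : ℝ) (k : ℕ) : ℝ :=
  sInf {t : ℝ | ENNReal.ofReal (1 - u) ≤ sampleLaw n φ {x | spacing x k ≤ t}}

/-- The corrected level `αₙ`. -/
def correctedLevel (φ : ℝ → ℝ) (n : ℕ) (α : ℝ) : ℝ :=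
  sSup {u : ℝ | u ∈ Set.Ioo (0 : ℝ) 1 ∧
    sampleLaw n φ {x | ∃ k ∈ indexSet n, nullQuantile φ n u k < spacing x k} ≤ ENNReal.ofReal α}

/-- The test `Ψ_α`: the supremum over `k ∈ 𝒦ₙ` of the indicators of
`X_(n-k+1) - X_(k) > q_{αₙ,k}`. -/
def orderTest (φ : ℝ → ℝ) (n : ℕ) (α : ℝ) (x : Fin n → ℝ) : ℕ :=
  (indexSet n).sup fun k =>
    Set.indicator {y : Fin n → ℝ | nullQuantile φ n (correctedLevel φ n α) k < spacing y k}
      (fun _ => 1) x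

/-- Level-`α` tests of the null hypothesis `f ∈ {φ(· - μ) : μ ∈ ℝ}`: measurable `{0,1}`-valued
functions of the sample whose probability of being `1` is at most `α` whatever `μ` is. -/
def IsLevelTest (φ : ℝ → ℝ) (n : ℕ) (α : ℝ) (T : (Fin n → ℝ) → ℕ) : Prop :=
  Measurable T ∧ (∀ x, T x = 0 ∨ T x = 1) ∧
    ∀ μ : ℝ, sampleLaw n (fun x => φ (x - μ)) {x | T x = 1} ≤ ENNReal.ofReal α

/-- The standard Gaussian density `φ_G`. -/
def gaussianDensity (x : ℝ) : ℝ :=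
  1 / Real.sqrt (2 * Real.pi) * Real.exp (-x ^ 2 / 2)

/-- The sparse detection boundary `r*(δ)`, for `1/2 < δ < 1`. -/
def sparseBoundary (δ : ℝ) : ℝ :=
  if δ < 3 / 4 then δ - 1 / 2 else (1 - Real.sqrt (1 - δ)) ^ 2

end

/-! The event X_(k) ≤ a says that at least k points lie in (-∞, a], so everything reduces to
Chebyshev's inequality for binomial counts.

Level: spacings are translation invariant, so the mean plays no role. They have no atoms, so each
single test has size exactly u, and the rejection probability is Lipschitz in u
(`sampleLaw_rejection_le_add`); hence the supremum α_n itself has level α. The union bound gives α_n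
≥ α/|𝒦_n|, a loss of order log n only.

Power: by `sampleLaw_orderTest_eq_zero_le` one k suffices. If n T(a) is below k by a margin, T being
the Gaussian tail, then q_{α_n,k} ≤ 2a. Under the mixture the spacing exceeds b + c ≥ 2a once the
expected counts above μ₁ + b and below μ₁ - c both exceed k by a margin.

Write s = √(2 log n), so that T(cs) = n^{-c² + o(1)}. If √r + √(1-δ) > 1, the range (k = 1) works:
about n^{1-δ} contaminated points reach √r s + √(1-δ) s > s, beyond the null maximum. Otherwise r >
r*(δ) forces δ - 1/2 < r < 1/4, and k ≈ n^{1-4r} works: beyond 2√r s there are about k null points,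
with fluctuation n^{1/2-2r}, and about n^{1-δ-r} contaminated points, which is larger exactly when r
> δ - 1/2. -/

/-! ### Order statistics and counts -/

/-- The number of sample points in `A`. -/
noncomputable def sampleCount {n : ℕ} (A : Set ℝ) (x : Fin n → ℝ) : ℝ :=
  ∑ i, A.indicator (fun _ => (1 : ℝ)) (x i)

open Classical in
theorem sampleCount_eq_card {n : ℕ} (A : Set ℝ) (x : Fin n → ℝ) :
    sampleCount A x = ((Finset.univ.filter fun i => x i ∈ A).card : ℝ) := by
  simp [sampleCount, Set.indicator_apply]

theorem measurable_sampleCount {n : ℕ} {A : Set ℝ} (hA : MeasurableSet A) :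
    Measurable (sampleCount (n := n) A) := by
  unfold sampleCount
  exact Finset.measurable_sum _ fun i _ =>
    (measurable_const.indicator hA).comp (measurable_pi_apply i)

theorem sampleCount_Iic_add_Ioi {n : ℕ} (a : ℝ) (x : Fin n → ℝ) :
    sampleCount (Set.Iic a) x + sampleCount (Set.Ioi a) x = n := by
  have h : ∀ i, (Set.Iic a).indicator (fun _ => (1 : ℝ)) (x i) +
      (Set.Ioi a).indicator (fun _ => (1 : ℝ)) (x i) = 1 := fun i => by
    by_cases hi : x i ≤ a
    · simp [hi]
    · simp [hi, not_le.1 hi]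
  simp [sampleCount, ← Finset.sum_add_distrib, h]

theorem orderStat_le_iff {n k : ℕ} (hk : 1 ≤ k) (hkn : k ≤ n) (x : Fin n → ℝ) (a : ℝ) :
    orderStat x k ≤ a ↔ (k : ℝ) ≤ sampleCount (Set.Iic a) x := by
  have h : k - 1 < n := by omega
  have h1 := Tuple.lt_card_le_iff_apply_le_of_monotone (j := ⟨k - 1, h⟩) (a := a)
    (Tuple.monotone_sort x)
  have h2 : (Finset.univ.filter fun i => (x ∘ Tuple.sort x) i ≤ a).card =
      (Finset.univ.filter fun i => x i ≤ a).card :=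
    Finset.card_bijective (Tuple.sort x) (Tuple.sort x).bijective (by simp)
  have h3 : sampleCount (Set.Iic a) x = ((Finset.univ.filter fun i => x i ≤ a).card : ℝ) := by
    rw [sampleCount_eq_card]
    congr 2
  rw [h2] at h1
  simp only [orderStat, h, dif_pos, h3, Nat.cast_le]
  change x (Tuple.sort x ⟨k - 1, h⟩) ≤ a ↔ _
  rw [← Function.comp_apply (f := x), ← h1]
  simp only
  omega

/-- The index n - k + 1 is that of the k-th largest point; pass to complements in
`orderStat_le_iff`. -/
theorem lt_orderStat_iff {n k : ℕ} (hk : 1 ≤ k) (hkn : k ≤ n) (x : Fin n → ℝ) (a : ℝ) :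
    a < orderStat x (n - k + 1) ↔ (k : ℝ) ≤ sampleCount (Set.Ioi a) x := by
  have h1 := orderStat_le_iff (k := n - k + 1) (by omega) (by omega) x a
  have h2 := sampleCount_Iic_add_Ioi a x
  rw [← not_le, h1, not_le, sampleCount_eq_card] at *
  rw [sampleCount_eq_card] at *
  norm_cast at *
  omega

theorem measurable_orderStat {n k : ℕ} (hk : 1 ≤ k) (hkn : k ≤ n) :
    Measurable fun x : Fin n → ℝ => orderStat x k := by
  refine measurable_of_Iic fun a => ?_
  have : (fun x : Fin n → ℝ => orderStat x k) ⁻¹' Set.Iic a =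
      sampleCount (Set.Iic a) ⁻¹' Set.Ici (k : ℝ) := by
    ext x; simp [orderStat_le_iff hk hkn]
  rw [this]
  exact measurable_sampleCount measurableSet_Iic measurableSet_Ici

theorem orderStat_add_const {n k : ℕ} (hk : 1 ≤ k) (hkn : k ≤ n) (x : Fin n → ℝ) (c : ℝ) :
    orderStat (fun i => x i + c) k = orderStat x k + c := by
  refine eq_of_forall_ge_iff fun a => ?_
  rw [← le_sub_iff_add_le, orderStat_le_iff hk hkn, orderStat_le_iff hk hkn]
  simp [sampleCount, Set.indicator_apply, le_sub_iff_add_le]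

/-! ### The dyadic index set and elementary properties of spacings. -/

theorem one_le_of_mem_indexSet {n k : ℕ} (hk : k ∈ indexSet n) : 1 ≤ k := by
  obtain ⟨j, -, rfl⟩ := Finset.mem_image.1 hk
  exact Nat.one_le_two_pow

theorem two_mul_le_of_mem_indexSet {n k : ℕ} (hn : 2 ≤ n) (hk : k ∈ indexSet n) :
    2 * k ≤ n := by
  obtain ⟨j, hj, rfl⟩ := Finset.mem_image.1 hk
  have := (Nat.le_log_iff_pow_le (b := 2) one_lt_two (by omega : n / 2 ≠ 0)).1
    (Nat.lt_succ_iff.1 (Finset.mem_range.1 hj))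
  omega

theorem two_pow_mem_indexSet {n j : ℕ} (hn : 2 ≤ n) (hj : 2 * 2 ^ j ≤ n) :
    2 ^ j ∈ indexSet n := by
  refine Finset.mem_image.2 ⟨j, Finset.mem_range.2 (Nat.lt_succ_of_le ?_), rfl⟩
  rw [Nat.le_log_iff_pow_le one_lt_two (by omega)]
  omega

theorem one_mem_indexSet {n : ℕ} (hn : 2 ≤ n) : 1 ∈ indexSet n :=
  two_pow_mem_indexSet (j := 0) hn (by omega)

theorem card_indexSet_pos {n : ℕ} (hn : 2 ≤ n) : 0 < (indexSet n).card :=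
  Finset.card_pos.2 ⟨1, one_mem_indexSet hn⟩

theorem card_indexSet_le (n : ℕ) : (indexSet n).card ≤ Nat.log 2 n + 1 := by
  refine Finset.card_image_le.trans ?_
  rw [Finset.card_range]
  exact Nat.succ_le_succ (Nat.log_mono_right (Nat.div_le_self _ _))

theorem measurable_spacing {n k : ℕ} (hk : 1 ≤ k) (hkn : k ≤ n) :
    Measurable fun x : Fin n → ℝ => spacing x k :=
  (measurable_orderStat (by omega) (by omega)).sub (measurable_orderStat hk hkn)

theorem measurable_spacing_of_mem {n k : ℕ} (hn : 2 ≤ n) (hk : k ∈ indexSet n) :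
    Measurable fun x : Fin n → ℝ => spacing x k :=
  measurable_spacing (one_le_of_mem_indexSet hk)
    (by have := two_mul_le_of_mem_indexSet hn hk; omega)

theorem spacing_add_const {n k : ℕ} (hk : 1 ≤ k) (hkn : k ≤ n) (x : Fin n → ℝ) (c : ℝ) :
    spacing (fun i => x i + c) k = spacing x k := by
  simp only [spacing]
  rw [orderStat_add_const (by omega) (by omega), orderStat_add_const hk hkn]
  ring

/-- The bound 2k ≤ n keeps the two ranks apart; having distinct coordinates is what excludes atoms
of the spacing. -/
theorem exists_spacing_eq_sub {n k : ℕ} (hk : 1 ≤ k) (hkn : 2 * k ≤ n) (x : Fin n → ℝ) :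
    ∃ i j : Fin n, i ≠ j ∧ spacing x k = x i - x j := by
  have h1 : n - k + 1 - 1 < n := by omega
  have h2 : k - 1 < n := by omega
  refine ⟨Tuple.sort x ⟨n - k + 1 - 1, h1⟩, Tuple.sort x ⟨k - 1, h2⟩, ?_, ?_⟩
  · rw [Ne, (Tuple.sort x).injective.eq_iff, Fin.mk.injEq]; omega
  · simp only [spacing, orderStat, h1, h2, dif_pos]

/-! ### Product measures -/

/-- Two distinct coordinates have joint law ν ⊗ ν, and the sections of the line p.1 - p.2 = t are
single points. -/
theorem pi_sub_eq_null {n : ℕ} (ν : Measure ℝ) [IsProbabilityMeasure ν] [NullSingletonClass ν]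
    {i j : Fin n} (hij : i ≠ j) (t : ℝ) :
    Measure.pi (fun _ : Fin n => ν) {x | x i - x j = t} = 0 := by
  have hind : (fun x : Fin n → ℝ => x i) ⟂ᵢ[Measure.pi (fun _ : Fin n => ν)] fun x => x j :=
    (iIndepFun_pi (μ := fun _ : Fin n => ν) (X := fun _ => id)
      fun _ => aemeasurable_id).indepFun hij
  have hmap := (indepFun_iff_map_prod_eq_prod_map_map
    (measurable_pi_apply i).aemeasurable (measurable_pi_apply j).aemeasurable).1 hind
  have he : ∀ l : Fin n, Measure.map (fun x : Fin n → ℝ => x l)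
      (Measure.pi (fun _ : Fin n => ν)) = ν := fun l =>
    (measurePreserving_eval (fun _ : Fin n => ν) l).map_eq
  rw [he, he] at hmap
  have hm : MeasurableSet {p : ℝ × ℝ | p.1 - p.2 = t} :=
    measurableSet_eq_fun (by fun_prop) (by fun_prop)
  have h2 : (ν.prod ν) {p : ℝ × ℝ | p.1 - p.2 = t} = 0 := by
    rw [Measure.measure_prod_null hm]
    refine Eventually.of_forall fun a => ?_
    have : Prod.mk a ⁻¹' {p : ℝ × ℝ | p.1 - p.2 = t} ⊆ {a - t} := fun y hy => by
      have : a - y = t := hy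
      simp only [Set.mem_singleton_iff]; linarith
    exact measure_mono_null this (measure_singleton _)
  rw [← hmap, Measure.map_apply (by fun_prop) hm] at h2
  exact h2

theorem pi_spacing_eq_null {n k : ℕ} (hk : 1 ≤ k) (hkn : 2 * k ≤ n) (ν : Measure ℝ)
    [IsProbabilityMeasure ν] [NullSingletonClass ν] (t : ℝ) :
    Measure.pi (fun _ : Fin n => ν) {x | spacing x k = t} = 0 := by
  have h : {x : Fin n → ℝ | spacing x k = t} ⊆
      ⋃ p : {p : Fin n × Fin n // p.1 ≠ p.2}, {x | x p.1.1 - x p.1.2 = t} := fun x hx => by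
    obtain ⟨i, j, hij, h⟩ := exists_spacing_eq_sub hk hkn x
    exact Set.mem_iUnion.2 ⟨⟨(i, j), hij⟩, h.symm.trans hx⟩
  exact measure_mono_null h (measure_iUnion_null fun p => pi_sub_eq_null ν p.2 t)

/-! ### Moments and deviations of counts. -/

theorem memLp_indicator_one (ν : Measure ℝ) [IsProbabilityMeasure ν] {A : Set ℝ}
    (hA : MeasurableSet A) : MemLp (A.indicator fun _ => (1 : ℝ)) 2 ν :=
  memLp_indicator_const 2 hA 1 (Or.inr (measure_ne_top _ _))

theorem memLp_sampleCount (n : ℕ) (ν : Measure ℝ) [IsProbabilityMeasure ν] {A : Set ℝ}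
    (hA : MeasurableSet A) :
    MemLp (sampleCount A) 2 (Measure.pi fun _ : Fin n => ν) := by
  unfold sampleCount
  exact memLp_finsetSum _ fun i _ => (memLp_indicator_one ν hA).comp_measurePreserving
    (measurePreserving_eval (fun _ : Fin n => ν) i)

theorem integral_sampleCount (n : ℕ) (ν : Measure ℝ) [IsProbabilityMeasure ν] {A : Set ℝ}
    (hA : MeasurableSet A) :
    ∫ x, sampleCount A x ∂(Measure.pi fun _ : Fin n => ν) = n * ν.real A := by
  unfold sampleCount
  rw [integral_finsetSum]
  · have : ∀ i : Fin n, ∫ x, A.indicator (fun _ => (1 : ℝ)) (x i)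
        ∂(Measure.pi fun _ : Fin n => ν) = ν.real A := fun i => by
      rw [← integral_indicator_one hA]
      exact integral_comp_eval (μ := fun _ : Fin n => ν) (i := i)
        (f := A.indicator fun _ => (1 : ℝ))
        (memLp_indicator_one ν hA).aestronglyMeasurable
    simp [this]
  · exact fun i _ => ((memLp_indicator_one ν hA).comp_measurePreserving
      (measurePreserving_eval (fun _ : Fin n => ν) i)).integrable (by norm_num)

theorem variance_sampleCount_le (n : ℕ) (ν : Measure ℝ) [IsProbabilityMeasure ν] {A : Set ℝ}
    (hA : MeasurableSet A) :
    Var[sampleCount A; Measure.pi fun _ : Fin n => ν] ≤ n * ν.real A := by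
  have h1 : sampleCount (n := n) A =
      ∑ i, fun x : Fin n → ℝ => A.indicator (fun _ => (1 : ℝ)) (x i) := by
    ext x; simp [sampleCount]
  rw [h1, variance_sum_pi (μ := fun _ : Fin n => ν)
    (X := fun _ => A.indicator fun _ => (1 : ℝ)) fun _ => memLp_indicator_one ν hA]
  have h2 : Var[A.indicator (fun _ => (1 : ℝ)); ν] ≤ ν.real A := by
    refine (variance_le_expectation_sq
      (memLp_indicator_one ν hA).aestronglyMeasurable).trans (le_of_eq ?_)
    rw [← integral_indicator_one hA]
    refine integral_congr_ae (Eventually.of_forall fun x => ?_)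
    by_cases hx : x ∈ A <;> simp [hx]
  simp only [Finset.sum_const, Finset.card_univ, Fintype.card_fin, nsmul_eq_mul]
  gcongr

/-- Chebyshev's inequality for the number of sample points in `A`. -/
theorem measure_le_abs_sampleCount_sub_le (n : ℕ) (ν : Measure ℝ) [IsProbabilityMeasure ν]
    {A : Set ℝ} (hA : MeasurableSet A) {c : ℝ} (hc : 0 < c) :
    Measure.pi (fun _ : Fin n => ν) {x | c ≤ |sampleCount A x - n * ν.real A|} ≤
      ENNReal.ofReal (n * ν.real A / c ^ 2) := by
  have h := meas_ge_le_variance_div_sq (memLp_sampleCount n ν hA) hc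
  rw [integral_sampleCount n ν hA] at h
  refine h.trans (ENNReal.ofReal_le_ofReal ?_)
  gcongr
  exact variance_sampleCount_le n ν hA

theorem measure_le_sampleCount_le (n : ℕ) (ν : Measure ℝ) [IsProbabilityMeasure ν]
    {A : Set ℝ} (hA : MeasurableSet A) {k m : ℝ} (hm : n * ν.real A ≤ m) (hk : m < k) :
    Measure.pi (fun _ : Fin n => ν) {x | k ≤ sampleCount A x} ≤
      ENNReal.ofReal (m / (k - m) ^ 2) := by
  refine (measure_mono fun x hx => ?_).trans
    ((measure_le_abs_sampleCount_sub_le n ν hA (c := k - m) (by linarith)).trans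
      (ENNReal.ofReal_le_ofReal (by gcongr)))
  simp only [Set.mem_ofPred_eq] at hx ⊢
  exact le_trans (by linarith) (le_abs_self _)

theorem measure_sampleCount_lt_le (n : ℕ) (ν : Measure ℝ) [IsProbabilityMeasure ν]
    {A : Set ℝ} (hA : MeasurableSet A) {k M : ℝ} (hk : 0 ≤ k) (hM : 0 < M)
    (hkM : k + M ≤ n * ν.real A) :
    Measure.pi (fun _ : Fin n => ν) {x | sampleCount A x < k} ≤
      ENNReal.ofReal ((k + M) / M ^ 2) := by
  refine (measure_mono fun x hx => ?_).trans
    ((measure_le_abs_sampleCount_sub_le n ν hA (c := n * ν.real A - k) (by linarith)).trans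
      (ENNReal.ofReal_le_ofReal ?_))
  · simp only [Set.mem_ofPred_eq] at hx ⊢
    exact le_trans (by linarith) (neg_le_abs _)
  -- The Chebyshev bound m / (m - k)² decreases in m > k, so the true mean may be replaced by its
  -- lower bound k + M.
  · set m := n * ν.real A
    rw [div_le_div_iff₀ (by nlinarith) (by positivity)]
    obtain ⟨s, hs, hms⟩ : ∃ s, 0 ≤ s ∧ m = k + M + s := ⟨m - (k + M), by linarith, by ring⟩
    rw [hms]
    have : 0 ≤ k * M * s := by positivity
    have : 0 ≤ k * s ^ 2 := by positivity
    have : 0 ≤ M * M * s := by positivity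
    have : 0 ≤ M * s ^ 2 := by positivity
    nlinarith

/-! ### Quantiles -/

section Quantile

variable {Ω : Type*} [MeasurableSpace Ω] (P : Measure Ω) [IsProbabilityMeasure P] {S : Ω → ℝ}

theorem ofReal_le_measure_le_iff (hS : Measurable S) {v : ℝ} (t : ℝ) :
    ENNReal.ofReal v ≤ P {x | S x ≤ t} ↔ v ≤ cdf (P.map S) t := by
  have := Measure.isProbabilityMeasure_map (μ := P) hS.aemeasurable
  rw [cdf_eq_real, map_measureReal_apply hS measurableSet_Iic]
  exact ENNReal.ofReal_le_iff_le_toReal (measure_ne_top _ _)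

theorem setOf_le_cdf_nonempty_bddBelow (ν : Measure ℝ) {u : ℝ}
    (hu : u ∈ Set.Ioo (0 : ℝ) 1) :
    {t : ℝ | 1 - u ≤ cdf ν t}.Nonempty ∧ BddBelow {t : ℝ | 1 - u ≤ cdf ν t} := by
  constructor
  · exact (((tendsto_cdf_atTop ν).eventually_const_lt
      (show 1 - u < 1 by linarith [hu.1])).exists).imp fun _ h => h.le
  · obtain ⟨b, hb⟩ := ((tendsto_cdf_atBot ν).eventually_lt_const
      (show 0 < 1 - u by linarith [hu.2])).exists
    exact ⟨b, fun t ht => le_of_not_gt fun h =>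
      absurd (ht.trans (monotone_cdf ν h.le)) (not_le.2 hb)⟩

/-- Right continuity of the distribution function F gives F(q) ≥ 1 - u; without atoms F is also left
continuous at q, which gives the reverse inequality. -/
theorem measure_quantile_lt (hS : Measurable S) (hatom : ∀ t, P {x | S x = t} = 0) {u : ℝ}
    (hu : u ∈ Set.Ioo (0 : ℝ) 1) :
    P.real {x | sInf {t : ℝ | ENNReal.ofReal (1 - u) ≤ P {x | S x ≤ t}} < S x} = u := by
  have := Measure.isProbabilityMeasure_map (μ := P) hS.aemeasurable
  simp only [ofReal_le_measure_le_iff P hS]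
  obtain ⟨hne, hbdd⟩ := setOf_le_cdf_nonempty_bddBelow (P.map S) hu
  set F := cdf (P.map S) with hF
  set q := sInf {t : ℝ | 1 - u ≤ F t} with hq
  have hge : 1 - u ≤ F q := by
    refine ge_of_tendsto (((F.right_continuous q).mono Set.Ioi_subset_Ici_self).tendsto) ?_
    filter_upwards [self_mem_nhdsWithin] with t ht
    obtain ⟨s, hs, hst⟩ := exists_lt_of_csInf_lt hne (show sInf _ < t from ht)
    exact le_trans hs (F.mono hst.le)
  have hle : F q ≤ 1 - u := by
    have hcont : Function.leftLim F q = F q := by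
      have h0 := F.measure_singleton q
      rw [hF, measure_cdf, Measure.map_apply hS (measurableSet_singleton _)] at h0
      have h1 : P (S ⁻¹' {q}) = 0 := hatom q
      rw [h1, eq_comm, ENNReal.ofReal_eq_zero] at h0
      exact le_antisymm (F.mono.leftLim_le le_rfl) (by linarith)
    rw [← hcont]
    refine le_of_tendsto (F.mono.tendsto_leftLim q) ?_
    filter_upwards [self_mem_nhdsWithin] with t ht
    exact (not_le.1 fun h => not_le.2 (show t < q from ht) (csInf_le hbdd h)).le
  have hc : {x | q < S x} = {x | S x ≤ q}ᶜ := by ext; simp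
  rw [hc, probReal_compl_eq_one_sub (measurableSet_le hS measurable_const)]
  have : P.real {x | S x ≤ q} = F q := by
    rw [hF, cdf_eq_real, map_measureReal_apply hS measurableSet_Iic]; rfl
  rw [this]; linarith

theorem quantile_le_of_measure_lt_le (hS : Measurable S) {u t : ℝ}
    (hu : u ∈ Set.Ioo (0 : ℝ) 1) (h : P {x | t < S x} ≤ ENNReal.ofReal u) :
    sInf {t : ℝ | ENNReal.ofReal (1 - u) ≤ P {x | S x ≤ t}} ≤ t := by
  have := Measure.isProbabilityMeasure_map (μ := P) hS.aemeasurable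
  have hc : {x | t < S x} = {x | S x ≤ t}ᶜ := by ext; simp
  have h1 : P.real {x | t < S x} ≤ u := ENNReal.toReal_le_of_le_ofReal hu.1.le h
  rw [hc, probReal_compl_eq_one_sub (measurableSet_le hS measurable_const)] at h1
  simp only [ofReal_le_measure_le_iff P hS]
  refine csInf_le (setOf_le_cdf_nonempty_bddBelow _ hu).2 ?_
  have : P.real {x | S x ≤ t} = cdf (P.map S) t := by
    rw [cdf_eq_real, map_measureReal_apply hS measurableSet_Iic]; rfl
  simp only [Set.mem_ofPred_eq, ← this]
  linarith

theorem quantile_antitone (hS : Measurable S) {u v : ℝ} (hu : u ∈ Set.Ioo (0 : ℝ) 1)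
    (hv : v ∈ Set.Ioo (0 : ℝ) 1) (huv : u ≤ v) :
    sInf {t : ℝ | ENNReal.ofReal (1 - v) ≤ P {x | S x ≤ t}} ≤
      sInf {t : ℝ | ENNReal.ofReal (1 - u) ≤ P {x | S x ≤ t}} := by
  simp only [ofReal_le_measure_le_iff P hS]
  refine csInf_le_csInf (setOf_le_cdf_nonempty_bddBelow _ hv).2
    (setOf_le_cdf_nonempty_bddBelow _ hu).1 fun t ht => ?_
  simp only [Set.mem_ofPred_eq] at ht ⊢
  linarith

end Quantile

/-! ### The Gaussian model -/

theorem gaussianDensity_sub_eq (μ x : ℝ) :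
    gaussianDensity (x - μ) = gaussianPDFReal μ 1 x := by
  simp [gaussianDensity, gaussianPDFReal]

theorem gaussianDensity_eq (x : ℝ) : gaussianDensity x = gaussianPDFReal 0 1 x := by
  simpa using gaussianDensity_sub_eq 0 x

theorem withDensity_gaussianDensity_sub (μ : ℝ) :
    (volume.withDensity fun x => ENNReal.ofReal (gaussianDensity (x - μ))) =
      gaussianReal μ 1 := by
  simp only [gaussianDensity_sub_eq]
  exact (gaussianReal_of_var_ne_zero μ one_ne_zero).symm

theorem sampleLaw_gaussianDensity_sub (n : ℕ) (μ : ℝ) :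
    sampleLaw n (fun x => gaussianDensity (x - μ)) =
      Measure.pi fun _ => gaussianReal μ 1 := by
  simp only [sampleLaw, withDensity_gaussianDensity_sub]

theorem sampleLaw_gaussianDensity (n : ℕ) :
    sampleLaw n gaussianDensity = Measure.pi fun _ => gaussianReal 0 1 := by
  simpa using sampleLaw_gaussianDensity_sub n 0

/-- The law of a two-component Gaussian mixture. -/
noncomputable def mixtureLaw (ε μ₁ μ₂ : ℝ) : Measure ℝ :=
  ENNReal.ofReal (1 - ε) • gaussianReal μ₁ 1 + ENNReal.ofReal ε • gaussianReal μ₂ 1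

theorem isProbabilityMeasure_mixtureLaw {ε : ℝ} (hε : ε ∈ Set.Icc (0 : ℝ) 1) (μ₁ μ₂ : ℝ) :
    IsProbabilityMeasure (mixtureLaw ε μ₁ μ₂) := by
  constructor
  simp only [mixtureLaw, Measure.coe_add, Measure.coe_smul, Pi.add_apply, Pi.smul_apply,
    measure_univ, smul_eq_mul, mul_one]
  rw [← ENNReal.ofReal_add (by linarith [hε.2]) hε.1]
  simp

theorem mixtureLaw_real {ε : ℝ} (hε : ε ∈ Set.Icc (0 : ℝ) 1) (μ₁ μ₂ : ℝ) (A : Set ℝ) :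
    (mixtureLaw ε μ₁ μ₂).real A =
      (1 - ε) * (gaussianReal μ₁ 1).real A + ε * (gaussianReal μ₂ 1).real A := by
  simp only [mixtureLaw, measureReal_def, Measure.coe_add, Measure.coe_smul, Pi.add_apply,
    Pi.smul_apply, smul_eq_mul]
  rw [ENNReal.toReal_add (by finiteness) (by finiteness), ENNReal.toReal_mul,
    ENNReal.toReal_mul, ENNReal.toReal_ofReal (by linarith [hε.2]), ENNReal.toReal_ofReal hε.1]

theorem measurable_gaussianDensity : Measurable gaussianDensity := by
  unfold gaussianDensity
  fun_prop

theorem gaussianDensity_nonneg (x : ℝ) : 0 ≤ gaussianDensity x := by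
  unfold gaussianDensity
  positivity

theorem sampleLaw_mixtureDensity (n : ℕ) {ε : ℝ} (hε : ε ∈ Set.Icc (0 : ℝ) 1) (μ₁ μ₂ : ℝ) :
    sampleLaw n (mixtureDensity gaussianDensity ε μ₁ μ₂) =
      Measure.pi fun _ => mixtureLaw ε μ₁ μ₂ := by
  have hm : ∀ μ : ℝ, Measurable fun x => ENNReal.ofReal (gaussianDensity (x - μ)) := fun μ =>
    (measurable_gaussianDensity.comp (measurable_id.sub_const μ)).ennreal_ofReal
  have h : (fun x => ENNReal.ofReal (mixtureDensity gaussianDensity ε μ₁ μ₂ x)) =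
      (ENNReal.ofReal (1 - ε) • fun x => ENNReal.ofReal (gaussianDensity (x - μ₁))) +
        ENNReal.ofReal ε • fun x => ENNReal.ofReal (gaussianDensity (x - μ₂)) := by
    ext x
    have h1 : 0 ≤ 1 - ε := by linarith [hε.2]
    simp only [mixtureDensity, Pi.add_apply, Pi.smul_apply, smul_eq_mul]
    rw [ENNReal.ofReal_add (mul_nonneg h1 (gaussianDensity_nonneg _))
      (mul_nonneg hε.1 (gaussianDensity_nonneg _)), ENNReal.ofReal_mul h1,
      ENNReal.ofReal_mul hε.1]
  simp only [sampleLaw, h]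
  rw [withDensity_add_left ((hm μ₁).const_smul _), withDensity_smul _ (hm μ₁),
    withDensity_smul _ (hm μ₂), withDensity_gaussianDensity_sub,
    withDensity_gaussianDensity_sub]
  rfl

/-! ### Null quantiles and the corrected level -/

instance isProbabilityMeasure_sampleLaw (n : ℕ) :
    IsProbabilityMeasure (sampleLaw n gaussianDensity) := by
  rw [sampleLaw_gaussianDensity]; infer_instance

theorem sampleLaw_spacing_eq_null {n k : ℕ} (hn : 2 ≤ n) (hk : k ∈ indexSet n) (t : ℝ) :
    sampleLaw n gaussianDensity {x | spacing x k = t} = 0 := by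
  have := nullSingletonClass_gaussianReal (μ := 0) (v := 1) one_ne_zero
  rw [sampleLaw_gaussianDensity]
  exact pi_spacing_eq_null (one_le_of_mem_indexSet hk) (two_mul_le_of_mem_indexSet hn hk) _ t

theorem sampleLaw_nullQuantile_lt {n k : ℕ} (hn : 2 ≤ n) (hk : k ∈ indexSet n) {u : ℝ}
    (hu : u ∈ Set.Ioo (0 : ℝ) 1) :
    (sampleLaw n gaussianDensity).real {x | nullQuantile gaussianDensity n u k < spacing x k} =
      u :=
  measure_quantile_lt _ (measurable_spacing_of_mem hn hk) (sampleLaw_spacing_eq_null hn hk) hu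

/-- The event that some spacing exceeds its null quantile of order `1 - u`. -/
def rejection (n : ℕ) (u : ℝ) : Set (Fin n → ℝ) :=
  {x | ∃ k ∈ indexSet n, nullQuantile gaussianDensity n u k < spacing x k}

theorem rejection_eq_biUnion (n : ℕ) (u : ℝ) :
    rejection n u =
      ⋃ k ∈ indexSet n, {x | nullQuantile gaussianDensity n u k < spacing x k} := by
  ext x; simp [rejection]

theorem measurableSet_rejection {n : ℕ} (hn : 2 ≤ n) (u : ℝ) :
    MeasurableSet (rejection n u) := by
  rw [rejection_eq_biUnion]
  exact Finset.measurableSet_biUnion _ fun k hk =>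
    measurableSet_lt measurable_const (measurable_spacing_of_mem hn hk)

/-- The test with k = 1 alone already has size u. This forces α_n ≤ α, so that α_n stays below 1. -/
theorem le_sampleLaw_rejection {n : ℕ} (hn : 2 ≤ n) {u : ℝ} (hu : u ∈ Set.Ioo (0 : ℝ) 1) :
    u ≤ (sampleLaw n gaussianDensity).real (rejection n u) := by
  have h1 := one_mem_indexSet hn
  conv_lhs => rw [← sampleLaw_nullQuantile_lt hn h1 hu]
  exact measureReal_mono fun x hx => ⟨1, h1, hx⟩

theorem sampleLaw_rejection_le {n : ℕ} (hn : 2 ≤ n) {u : ℝ} (hu : u ∈ Set.Ioo (0 : ℝ) 1) :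
    (sampleLaw n gaussianDensity).real (rejection n u) ≤ (indexSet n).card * u := by
  rw [rejection_eq_biUnion]
  refine (measureReal_biUnion_finset_le _ _).trans (le_of_eq ?_)
  rw [Finset.sum_congr rfl fun k hk => sampleLaw_nullQuantile_lt hn hk hu]
  simp

/-- Quantiles decrease in the level, so for each k the event at u sits inside the event at v and the
difference has mass exactly v - u. This continuity carries the level constraint over to the supremum
α_n. -/
theorem sampleLaw_rejection_le_add {n : ℕ} (hn : 2 ≤ n) {u v : ℝ}
    (hu : u ∈ Set.Ioo (0 : ℝ) 1) (hv : v ∈ Set.Ioo (0 : ℝ) 1) (huv : u ≤ v) :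
    (sampleLaw n gaussianDensity).real (rejection n v) ≤
      (sampleLaw n gaussianDensity).real (rejection n u) + (indexSet n).card * (v - u) := by
  have hsub : rejection n v ⊆ rejection n u ∪ ⋃ k ∈ indexSet n,
      ({x | nullQuantile gaussianDensity n v k < spacing x k} \
        {x | nullQuantile gaussianDensity n u k < spacing x k}) := by
    rintro x ⟨k, hk, hx⟩
    by_cases h : nullQuantile gaussianDensity n u k < spacing x k
    · exact Or.inl ⟨k, hk, h⟩
    · exact Or.inr (Set.mem_biUnion hk ⟨hx, h⟩)
  refine (measureReal_mono hsub).trans ((measureReal_union_le _ _).trans ?_)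
  gcongr
  refine (measureReal_biUnion_finset_le _ _).trans (le_of_eq ?_)
  rw [Finset.sum_congr rfl fun k hk => ?_, Finset.sum_const, nsmul_eq_mul]
  have hS := measurable_spacing_of_mem hn hk
  have hle : nullQuantile gaussianDensity n v k ≤ nullQuantile gaussianDensity n u k :=
    quantile_antitone (sampleLaw n gaussianDensity) hS hu hv huv
  have hss : {x : Fin n → ℝ | nullQuantile gaussianDensity n u k < spacing x k} ⊆
      {x | nullQuantile gaussianDensity n v k < spacing x k} :=
    fun x hx => lt_of_le_of_lt hle hx
  rw [measureReal_sdiff hss (measurableSet_lt measurable_const hS), sampleLaw_nullQuantile_lt hn hk hu,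
    sampleLaw_nullQuantile_lt hn hk hv]

theorem correctedLevel_eq (n : ℕ) {α : ℝ} (hα : 0 ≤ α) :
    correctedLevel gaussianDensity n α = sSup {u : ℝ | u ∈ Set.Ioo (0 : ℝ) 1 ∧
      (sampleLaw n gaussianDensity).real (rejection n u) ≤ α} := by
  have h : ∀ u, sampleLaw n gaussianDensity (rejection n u) ≤ ENNReal.ofReal α ↔
      (sampleLaw n gaussianDensity).real (rejection n u) ≤ α := fun u =>
    ENNReal.le_ofReal_iff_toReal_le (measure_ne_top _ _) hα
  simp only [← h]
  rfl

/-- Bonferroni's correction is an admissible level. -/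
theorem div_card_mem {n : ℕ} (hn : 2 ≤ n) {α : ℝ} (hα : α ∈ Set.Ioo (0 : ℝ) 1) :
    α / (indexSet n).card ∈ {u : ℝ | u ∈ Set.Ioo (0 : ℝ) 1 ∧
      (sampleLaw n gaussianDensity).real (rejection n u) ≤ α} := by
  have h1 : (1 : ℝ) ≤ (indexSet n).card := by exact_mod_cast card_indexSet_pos hn
  have h2 : α / (indexSet n).card ∈ Set.Ioo (0 : ℝ) 1 :=
    ⟨div_pos hα.1 (by linarith), by rw [div_lt_one (by linarith)]; linarith [hα.2]⟩
  refine ⟨h2, (sampleLaw_rejection_le hn h2).trans_eq ?_⟩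
  field_simp

theorem div_card_le_correctedLevel {n : ℕ} (hn : 2 ≤ n) {α : ℝ} (hα : α ∈ Set.Ioo (0 : ℝ) 1) :
    α / (indexSet n).card ≤ correctedLevel gaussianDensity n α := by
  rw [correctedLevel_eq n hα.1.le]
  exact le_csSup ⟨1, fun u hu => hu.1.2.le⟩ (div_card_mem hn hα)

theorem correctedLevel_mem {n : ℕ} (hn : 2 ≤ n) {α : ℝ} (hα : α ∈ Set.Ioo (0 : ℝ) 1) :
    correctedLevel gaussianDensity n α ∈ Set.Ioo (0 : ℝ) 1 := by
  refine ⟨(div_card_mem hn hα).1.1.trans_le (div_card_le_correctedLevel hn hα), ?_⟩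
  rw [correctedLevel_eq n hα.1.le]
  exact (csSup_le ⟨_, div_card_mem hn hα⟩ fun u hu =>
    (le_sampleLaw_rejection hn hu.1).trans hu.2).trans_lt hα.2

theorem sampleLaw_rejection_correctedLevel_le {n : ℕ} (hn : 2 ≤ n) {α : ℝ}
    (hα : α ∈ Set.Ioo (0 : ℝ) 1) :
    (sampleLaw n gaussianDensity).real
      (rejection n (correctedLevel gaussianDensity n α)) ≤ α := by
  have hmem := correctedLevel_mem hn hα
  have hK : (0 : ℝ) < (indexSet n).card := by exact_mod_cast card_indexSet_pos hn
  refine le_of_forall_pos_le_add fun η hη => ?_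
  have hlt : correctedLevel gaussianDensity n α - η / (indexSet n).card <
      correctedLevel gaussianDensity n α := by linarith [div_pos hη hK]
  have hbdd : BddAbove {u : ℝ | u ∈ Set.Ioo (0 : ℝ) 1 ∧
      (sampleLaw n gaussianDensity).real (rejection n u) ≤ α} := ⟨1, fun u hu => hu.1.2.le⟩
  obtain ⟨u, hu, hlu⟩ := exists_lt_of_lt_csSup ⟨_, div_card_mem hn hα⟩
    (hlt.trans_eq (correctedLevel_eq n hα.1.le))
  have hle : u ≤ correctedLevel gaussianDensity n α := by
    rw [correctedLevel_eq n hα.1.le]; exact le_csSup hbdd hu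
  refine (sampleLaw_rejection_le_add hn hu.1 hmem hle).trans (add_le_add hu.2 ?_)
  calc ((indexSet n).card : ℝ) * (correctedLevel gaussianDensity n α - u)
      ≤ (indexSet n).card * (η / (indexSet n).card) := by gcongr; linarith
    _ = η := by field_simp

/-! ### The test as an indicator, and its level. -/

theorem orderTest_eq_zero_iff {n : ℕ} (α : ℝ) (x : Fin n → ℝ) :
    orderTest gaussianDensity n α x = 0 ↔
      x ∉ rejection n (correctedLevel gaussianDensity n α) := by
  simp [orderTest, rejection, Finset.sup_eq_zero, Set.indicator_apply]

theorem orderTest_eq_indicator {n : ℕ} (α : ℝ) :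
    orderTest gaussianDensity n α =
      (rejection n (correctedLevel gaussianDensity n α)).indicator fun _ => 1 := by
  ext x
  have hle : orderTest gaussianDensity n α x ≤ 1 :=
    Finset.sup_le fun k _ => Set.indicator_le_self' (fun _ _ => zero_le_one) x
  by_cases hx : x ∈ rejection n (correctedLevel gaussianDensity n α)
  · rw [Set.indicator_of_mem hx]
    have := mt (orderTest_eq_zero_iff α x).1 (not_not.2 hx)
    omega
  · rw [Set.indicator_of_notMem hx, (orderTest_eq_zero_iff α x).2 hx]

theorem orderTest_eq_one_iff {n : ℕ} (α : ℝ) (x : Fin n → ℝ) :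
    orderTest gaussianDensity n α x = 1 ↔
      x ∈ rejection n (correctedLevel gaussianDensity n α) := by
  rw [orderTest_eq_indicator]
  simp

theorem sampleLaw_shift_rejection {n : ℕ} (hn : 2 ≤ n) (μ u : ℝ) :
    sampleLaw n (fun x => gaussianDensity (x - μ)) (rejection n u) =
      sampleLaw n gaussianDensity (rejection n u) := by
  have hmap : sampleLaw n (fun x => gaussianDensity (x - μ)) =
      (sampleLaw n gaussianDensity).map fun x i => x i + μ := by
    rw [sampleLaw_gaussianDensity_sub, sampleLaw_gaussianDensity]
    have : gaussianReal μ 1 = (gaussianReal 0 1).map (· + μ) := by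
      rw [gaussianReal_map_add_const, zero_add]
    have hs : SigmaFinite ((gaussianReal 0 1).map (· + μ)) := by rw [← this]; infer_instance
    rw [this]
    exact (Measure.pi_map_pi (f := fun _ : Fin n => (· + μ)) fun _ => by fun_prop).symm
  rw [hmap, Measure.map_apply (by fun_prop) (measurableSet_rejection hn u)]
  congr 1
  ext x
  refine exists_congr fun k => and_congr_right fun hk => ?_
  rw [spacing_add_const (one_le_of_mem_indexSet hk)
    (by have := two_mul_le_of_mem_indexSet hn hk; omega)]

theorem isLevelTest_orderTest {n : ℕ} (hn : 2 ≤ n) {α : ℝ} (hα : α ∈ Set.Ioo (0 : ℝ) 1) :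
    IsLevelTest gaussianDensity n α (orderTest gaussianDensity n α) := by
  refine ⟨?_, fun x => ?_, fun μ => ?_⟩
  · rw [orderTest_eq_indicator]
    exact measurable_const.indicator (measurableSet_rejection hn _)
  · rw [orderTest_eq_indicator]
    exact Set.indicator_eq_zero_or_self _ _ _
  · simp only [orderTest_eq_one_iff, Set.ofPred_mem_eq]
    rw [sampleLaw_shift_rejection hn]
    exact (ENNReal.le_ofReal_iff_toReal_le (measure_ne_top _ _) hα.1.le).2
      (sampleLaw_rejection_correctedLevel_le hn hα)

/-! ### Gaussian tails -/

/-- The standard Gaussian survival function. -/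
noncomputable def gaussTail (a : ℝ) : ℝ := (gaussianReal 0 1).real (Set.Ioi a)

theorem gaussianReal_real_Ioi (μ b : ℝ) :
    (gaussianReal μ 1).real (Set.Ioi b) = gaussTail (b - μ) := by
  have : gaussianReal μ 1 = (gaussianReal 0 1).map (· + μ) := by
    rw [gaussianReal_map_add_const, zero_add]
  rw [this, map_measureReal_apply (by fun_prop) measurableSet_Ioi, gaussTail]
  simp

theorem gaussianReal_real_Iic (μ b : ℝ) :
    (gaussianReal μ 1).real (Set.Iic b) = gaussTail (μ - b) := by
  have : gaussianReal μ 1 = (gaussianReal (-μ) 1).map (- ·) := by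
    rw [gaussianReal_map_neg, neg_neg]
  have h := nullSingletonClass_gaussianReal (μ := -μ) (v := 1) one_ne_zero
  rw [this, map_measureReal_apply (by fun_prop) measurableSet_Iic]
  have h2 : (fun x : ℝ => -x) ⁻¹' Set.Iic b = Set.Ici (-b) := by ext; simp
  rw [h2, measureReal_congr Ioi_ae_eq_Ici.symm, gaussianReal_real_Ioi]
  congr 1; ring

theorem gaussTail_nonneg (a : ℝ) : 0 ≤ gaussTail a := measureReal_nonneg

theorem gaussTail_antitone : Antitone gaussTail := fun _ _ h =>
  measureReal_mono (Set.Ioi_subset_Ioi h)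

theorem continuous_gaussianDensity : Continuous gaussianDensity := by
  unfold gaussianDensity
  fun_prop

theorem gaussianDensity_antitoneOn {x y : ℝ} (hx : 0 ≤ x) (hxy : x ≤ y) :
    gaussianDensity y ≤ gaussianDensity x := by
  unfold gaussianDensity
  gcongr

theorem gaussTail_sub_eq_integral {a b : ℝ} (hab : a ≤ b) :
    gaussTail a - gaussTail b = ∫ x in a..b, gaussianDensity x := by
  have h : gaussTail a = gaussTail b + (gaussianReal 0 1).real (Set.Ioc a b) := by
    rw [gaussTail, gaussTail, ← Set.Ioc_union_Ioi_eq_Ioi hab, add_comm,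
      measureReal_union Set.Ioc_disjoint_Ioi_same measurableSet_Ioi]
  rw [h, add_sub_cancel_left, intervalIntegral.integral_of_le hab, measureReal_def,
    gaussianReal_apply_eq_integral _ one_ne_zero, ENNReal.toReal_ofReal]
  · simp only [gaussianDensity_eq]
  · exact setIntegral_nonneg measurableSet_Ioc fun x _ => gaussianPDFReal_nonneg _ _ _

theorem continuous_gaussTail : Continuous gaussTail := by
  have h : gaussTail = fun a => gaussTail 0 - ∫ x in (0 : ℝ)..a, gaussianDensity x := by
    ext a
    rcases le_total 0 a with ha | ha
    · rw [← gaussTail_sub_eq_integral ha]; ring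
    · rw [intervalIntegral.integral_symm, ← gaussTail_sub_eq_integral ha]; ring
  rw [h]
  exact continuous_const.sub (intervalIntegral.continuous_primitive
    (fun _ _ => continuous_gaussianDensity.intervalIntegrable _ _) 0)

/-- Chernoff's bound with parameter x. -/
theorem gaussTail_le_exp {x : ℝ} (hx : 0 ≤ x) : gaussTail x ≤ Real.exp (-x ^ 2 / 2) := by
  have h := measure_ge_le_exp_mul_mgf (X := id) (μ := gaussianReal 0 1) x hx
    (integrable_exp_mul_gaussianReal x)
  rw [mgf_gaussianReal (μ := 0) (v := 1) Measure.map_id, ← Real.exp_add] at h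
  refine (measureReal_mono fun y hy => (Set.mem_Ioi.1 hy).le).trans (h.trans_eq ?_)
  congr 1
  push_cast
  ring

/-- Only [x, x + 1] is kept. The unit shift is crude but negligible at the scale √(2 log n). -/
theorem gaussianDensity_le_gaussTail {x : ℝ} (hx : 0 ≤ x) :
    gaussianDensity (x + 1) ≤ gaussTail x := by
  have h := gaussTail_sub_eq_integral (show x ≤ x + 1 by linarith)
  have h2 : ∫ _ in x..(x + 1), gaussianDensity (x + 1) ≤ ∫ t in x..(x + 1), gaussianDensity t :=
    intervalIntegral.integral_mono_on (by linarith) (by simp)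
      (continuous_gaussianDensity.intervalIntegrable _ _) fun t ht =>
        gaussianDensity_antitoneOn (hx.trans ht.1) ht.2
  rw [intervalIntegral.integral_const] at h2
  simp only [add_sub_cancel_left, one_smul] at h2
  linarith [gaussTail_nonneg (x + 1)]

/-- Midpoint convexity of the tail on [0, ∞), where the density decreases. -/
theorem two_mul_gaussTail_le {a h : ℝ} (h0 : 0 ≤ h) (ha : h ≤ a) :
    2 * gaussTail a ≤ gaussTail (a - h) + gaussTail (a + h) := by
  have h1 := gaussTail_sub_eq_integral (show a - h ≤ a by linarith)
  have h2 := gaussTail_sub_eq_integral (show a ≤ a + h by linarith)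
  have h3 : ∫ x in a..(a + h), gaussianDensity x =
      ∫ x in (a - h)..a, gaussianDensity (x + h) := by
    rw [intervalIntegral.integral_comp_add_right, sub_add_cancel]
  have h4 : ∫ x in (a - h)..a, gaussianDensity (x + h) ≤
      ∫ x in (a - h)..a, gaussianDensity x :=
    intervalIntegral.integral_mono_on (by linarith)
      ((continuous_gaussianDensity.comp (continuous_add_const h)).intervalIntegrable _ _)
      (continuous_gaussianDensity.intervalIntegrable _ _) fun t ht =>
        gaussianDensity_antitoneOn (by linarith [ht.1]) (by linarith)
  linarith

theorem tendsto_gaussTail_atTop : Tendsto gaussTail atTop (𝓝 0) := by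
  have h : Tendsto (fun x : ℝ => Real.exp (-x ^ 2 / 2)) atTop (𝓝 0) := by
    refine Real.tendsto_exp_atBot.comp ?_
    have : Tendsto (fun x : ℝ => x ^ 2 / 2) atTop atTop :=
      (tendsto_pow_atTop two_ne_zero).atTop_div_const two_pos
    simpa only [neg_div, Function.comp_def] using tendsto_neg_atTop_atBot.comp this
  refine tendsto_of_tendsto_of_tendsto_of_le_of_le' tendsto_const_nhds h
    (Eventually.of_forall gaussTail_nonneg) ?_
  filter_upwards [eventually_ge_atTop 0] with x hx using gaussTail_le_exp hx

theorem exists_gaussTail_eq {p : ℝ} (hp : 0 < p) (hp' : p ≤ gaussianDensity 1) :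
    ∃ a, 0 ≤ a ∧ gaussTail a = p := by
  obtain ⟨b, hb, hb0⟩ := ((tendsto_gaussTail_atTop.eventually_lt_const hp).and
    (eventually_ge_atTop 0)).exists
  obtain ⟨a, ha, hap⟩ := intermediate_value_Icc' hb0 continuous_gaussTail.continuousOn
    ⟨hb.le, hp'.trans (by simpa using gaussianDensity_le_gaussTail le_rfl)⟩
  exact ⟨a, ha.1, hap⟩

/-! ### A finite-sample bound for the probability of error -/

theorem sampleLaw_spacing_gt_le {n k : ℕ} (hk : 1 ≤ k) (hkn : k ≤ n) {a m : ℝ}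
    (hm : n * gaussTail a ≤ m) (hmk : m < k) :
    sampleLaw n gaussianDensity {x | 2 * a < spacing x k} ≤
      ENNReal.ofReal (2 * (m / (k - m) ^ 2)) := by
  have hm0 : 0 ≤ m := le_trans (mul_nonneg n.cast_nonneg (gaussTail_nonneg a)) hm
  have hsub : {x : Fin n → ℝ | 2 * a < spacing x k} ⊆
      {x | (k : ℝ) ≤ sampleCount (Set.Ioi a) x} ∪
        {x | (k : ℝ) ≤ sampleCount (Set.Iic (-a)) x} := fun x hx => by
    by_contra h
    simp only [Set.mem_union, Set.mem_ofPred_eq, not_or, ← lt_orderStat_iff hk hkn,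
      ← orderStat_le_iff hk hkn] at h hx
    simp only [spacing] at hx
    linarith [h.1, h.2]
  rw [sampleLaw_gaussianDensity]
  refine (measure_mono hsub).trans ((measure_union_le _ _).trans ?_)
  rw [two_mul, ENNReal.ofReal_add (by positivity) (by positivity)]
  refine add_le_add (measure_le_sampleCount_le n _ measurableSet_Ioi ?_ hmk)
    (measure_le_sampleCount_le n _ measurableSet_Iic ?_ hmk)
  · exact hm
  · rw [gaussianReal_real_Iic]; simpa using hm

/-- The hypotheses on `m` put the null quantile below 2a, through α/|𝒦_n| ≤ α_n. Those on `M` make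
both mixture counts reach k, up to probability β. In the lower count the contaminated points are
simply dropped. -/
theorem sampleLaw_orderTest_eq_zero_le {n k : ℕ} (hn : 2 ≤ n) (hk : k ∈ indexSet n)
    {α β ε μ₁ μ₂ a b c m M : ℝ} (hα : α ∈ Set.Ioo (0 : ℝ) 1) (hε : ε ∈ Set.Icc (0 : ℝ) 1)
    (habc : 2 * a ≤ b + c) (hm : n * gaussTail a ≤ m) (hmk : m < k)
    (hmα : 2 * (m / (k - m) ^ 2) ≤ α / (indexSet n).card) (hM : 0 < M)
    (hb : k + M ≤ n * ((1 - ε) * gaussTail b + ε * gaussTail (b - (μ₂ - μ₁))))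
    (hc : k + M ≤ n * ((1 - ε) * gaussTail c)) (hβ : 2 * ((k + M) / M ^ 2) ≤ β) :
    sampleLaw n (mixtureDensity gaussianDensity ε μ₁ μ₂)
      {x | orderTest gaussianDensity n α x = 0} ≤ ENNReal.ofReal β := by
  have hk1 := one_le_of_mem_indexSet hk
  have hkn : k ≤ n := by have := two_mul_le_of_mem_indexSet hn hk; omega
  have hq : nullQuantile gaussianDensity n (correctedLevel gaussianDensity n α) k ≤ 2 * a :=
    quantile_le_of_measure_lt_le (sampleLaw n gaussianDensity)
      (measurable_spacing_of_mem hn hk) (correctedLevel_mem hn hα)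
      ((sampleLaw_spacing_gt_le hk1 hkn hm hmk).trans (ENNReal.ofReal_le_ofReal
        (hmα.trans (div_card_le_correctedLevel hn hα))))
  have hsub : {x : Fin n → ℝ | orderTest gaussianDensity n α x = 0} ⊆
      {x | sampleCount (Set.Ioi (μ₁ + b)) x < k} ∪
        {x | sampleCount (Set.Iic (μ₁ - c)) x < k} := fun x hx => by
    by_contra h
    simp only [Set.mem_union, Set.mem_ofPred_eq, not_or, not_lt, ← lt_orderStat_iff hk1 hkn,
      ← orderStat_le_iff hk1 hkn] at h
    refine (orderTest_eq_zero_iff α x).1 hx ⟨k, hk, ?_⟩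
    simp only [spacing]
    linarith [h.1, h.2]
  have := isProbabilityMeasure_mixtureLaw hε μ₁ μ₂
  rw [sampleLaw_mixtureDensity n hε]
  refine (measure_mono hsub).trans ((measure_union_le _ _).trans
    (le_trans ?_ (ENNReal.ofReal_le_ofReal hβ)))
  rw [two_mul, ENNReal.ofReal_add (by positivity) (by positivity)]
  refine add_le_add
    (measure_sampleCount_lt_le n _ measurableSet_Ioi k.cast_nonneg hM (hb.trans_eq ?_))
    (measure_sampleCount_lt_le n _ measurableSet_Iic k.cast_nonneg hM (hc.trans ?_))
  · rw [mixtureLaw_real hε, gaussianReal_real_Ioi, gaussianReal_real_Ioi]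
    congr 4 <;> ring
  · rw [mixtureLaw_real hε, gaussianReal_real_Iic, gaussianReal_real_Iic, sub_sub_cancel]
    have := mul_nonneg hε.1 (gaussTail_nonneg (μ₂ - (μ₁ - c)))
    gcongr
    linarith

/-! ### Asymptotics -/

theorem eventually_mul_rpow_le (C : ℝ) {p q : ℝ} (hpq : p < q) :
    ∀ᶠ n : ℕ in atTop, C * (n : ℝ) ^ p ≤ (n : ℝ) ^ q := by
  filter_upwards [((tendsto_rpow_atTop (sub_pos.2 hpq)).comp
    tendsto_natCast_atTop_atTop).eventually_ge_atTop C, eventually_gt_atTop 0] with n hn hn0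
  have h0 : (0 : ℝ) < n := by exact_mod_cast hn0
  calc C * (n : ℝ) ^ p ≤ (n : ℝ) ^ (q - p) * (n : ℝ) ^ p := by gcongr; exact hn
    _ = (n : ℝ) ^ q := by rw [← Real.rpow_add h0, sub_add_cancel]

theorem eventually_mul_rpow_neg_le (C : ℝ) {p b : ℝ} (hp : p < 0) (hb : 0 < b) :
    ∀ᶠ n : ℕ in atTop, C * (n : ℝ) ^ p ≤ b := by
  have h := ((tendsto_rpow_neg_atTop (neg_pos.2 hp)).comp
    tendsto_natCast_atTop_atTop).const_mul C
  rw [mul_zero] at h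
  filter_upwards [h.eventually_le_const hb] with n hn
  simpa using hn

/-- As |𝒦_n| = O(log n), half of the exponent `p` absorbs it and the other half tends to zero. -/
theorem eventually_mul_rpow_neg_le_div_card (C : ℝ) {p α : ℝ} (hp : p < 0) (hα : 0 < α) :
    ∀ᶠ n : ℕ in atTop, C * (n : ℝ) ^ p ≤ α / (indexSet n).card := by
  have hlog := (isLittleO_log_rpow_atTop (r := -p / 2) (by linarith)).bound
    (Real.log_pos one_lt_two)
  have h2 := tendsto_natCast_atTop_atTop (R := ℝ) |>.eventually hlog
  filter_upwards [h2, eventually_mul_rpow_neg_le (2 * C) (p := p / 2) (by linarith) hα,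
    eventually_ge_atTop 2] with n hn hC hn2
  have h1 : (1 : ℝ) ≤ n := by exact_mod_cast (by omega : 1 ≤ n)
  have h0 : (0 : ℝ) < n := by linarith
  have hK : (0 : ℝ) < (indexSet n).card := by exact_mod_cast card_indexSet_pos hn2
  have hK2 : ((indexSet n).card : ℝ) ≤ 2 * (n : ℝ) ^ (-p / 2) := by
    have ha : ((indexSet n).card : ℝ) ≤ Nat.log 2 n + 1 := by
      exact_mod_cast card_indexSet_le n
    have hb : (Nat.log 2 n : ℝ) ≤ Real.log n / Real.log 2 := by
      simpa [Real.logb] using Real.natLog_le_logb n 2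
    rw [Real.norm_of_nonneg (Real.log_nonneg h1), Real.norm_of_nonneg (by positivity)] at hn
    have hc : Real.log n / Real.log 2 ≤ (n : ℝ) ^ (-p / 2) := by
      rw [div_le_iff₀ (Real.log_pos one_lt_two), mul_comm]; exact hn
    have hd : (1 : ℝ) ≤ (n : ℝ) ^ (-p / 2) := Real.one_le_rpow h1 (by linarith)
    linarith
  rw [le_div_iff₀ hK]
  rcases le_total C 0 with hC0 | hC0
  · exact (mul_nonpos_of_nonpos_of_nonneg (mul_nonpos_of_nonpos_of_nonneg hC0
      (by positivity)) hK.le).trans hα.le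
  · calc C * (n : ℝ) ^ p * (indexSet n).card
        ≤ C * (n : ℝ) ^ p * (2 * (n : ℝ) ^ (-p / 2)) := by gcongr
      _ = 2 * C * ((n : ℝ) ^ p * (n : ℝ) ^ (-p / 2)) := by ring
      _ = 2 * C * (n : ℝ) ^ (p / 2) := by rw [← Real.rpow_add h0]; ring_nf
      _ ≤ α := hC

theorem exp_neg_sq_mul_sqrt_log {n : ℕ} (hn : 1 ≤ n) (c : ℝ) :
    Real.exp (-(c * √(2 * Real.log n)) ^ 2 / 2) = (n : ℝ) ^ (-c ^ 2) := by
  have h1 : (1 : ℝ) ≤ n := by exact_mod_cast hn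
  rw [mul_pow, Real.sq_sqrt (by have := Real.log_nonneg h1; linarith),
    Real.rpow_def_of_pos (by linarith)]
  congr 1
  ring

theorem gaussTail_mul_sqrt_log_le {n : ℕ} (hn : 1 ≤ n) {c : ℝ} (hc : 0 ≤ c) :
    gaussTail (c * √(2 * Real.log n)) ≤ (n : ℝ) ^ (-c ^ 2) := by
  rw [← exp_neg_sq_mul_sqrt_log hn]
  exact gaussTail_le_exp (by positivity)

theorem tendsto_sqrt_log_natCast :
    Tendsto (fun n : ℕ => √(2 * Real.log n)) atTop atTop :=
  Real.tendsto_sqrt_atTop.comp (Tendsto.const_mul_atTop two_pos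
    (Real.tendsto_log_atTop.comp tendsto_natCast_atTop_atTop))

theorem eventually_rpow_neg_le_gaussTail {y : ℕ → ℝ} {l κ : ℝ} (hl : 0 ≤ l) (hκ : l ^ 2 < κ)
    (hy : Tendsto (fun n : ℕ => y n / √(2 * Real.log n)) atTop (𝓝 l)) :
    ∀ᶠ n : ℕ in atTop, (n : ℝ) ^ (-κ) ≤ gaussTail (y n) := by
  have hκ0 : 0 ≤ κ := (sq_nonneg l).trans hκ.le
  -- Three margins in l < w < v < √κ: the first absorbs the limit, the second the unit shift of
  -- `gaussianDensity_le_gaussTail`, the third the factor √(2π).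
  obtain ⟨v, hlv, hvκ⟩ := exists_between ((Real.lt_sqrt hl).2 hκ)
  obtain ⟨w, hlw, hwv⟩ := exists_between hlv
  have hv0 : 0 < v := by linarith
  have hv2 : v ^ 2 < κ := (Real.lt_sqrt hv0.le).1 hvκ
  filter_upwards [hy.eventually_lt_const hlw,
    tendsto_sqrt_log_natCast.eventually_ge_atTop (1 / (v - w)),
    tendsto_sqrt_log_natCast.eventually_gt_atTop 0,
    eventually_mul_rpow_le (√(2 * Real.pi)) (show -κ < -v ^ 2 by linarith),
    tendsto_sqrt_log_natCast.eventually_ge_atTop (1 / v),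
    eventually_ge_atTop 1] with n h1 h2 h3 h4 h5 h6
  rw [div_lt_iff₀ h3] at h1
  rw [div_le_iff₀ (by linarith)] at h2 h5
  set x := √(2 * Real.log n)
  have hle : y n ≤ v * x - 1 := by nlinarith
  refine le_trans ?_ (gaussTail_antitone hle)
  refine le_trans ?_ (gaussianDensity_le_gaussTail (by linarith))
  rw [sub_add_cancel, gaussianDensity, exp_neg_sq_mul_sqrt_log h6, one_div,
    ← div_eq_inv_mul, le_div_iff₀ (by positivity), mul_comm]
  exact h4

theorem eventually_sparsity_bounds {δ : ℝ} (hδ : 0 < δ) {ε : ℕ → ℝ}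
    (hε : Tendsto (fun n : ℕ => ε n / (n : ℝ) ^ (-δ)) atTop (𝓝 1)) :
    ∀ᶠ n : ℕ in atTop, (n : ℝ) ^ (-δ) / 2 ≤ ε n ∧ ε n ≤ 2 * (n : ℝ) ^ (-δ) ∧
      ε n ∈ Set.Icc (0 : ℝ) (1 / 2) := by
  filter_upwards [hε.eventually_const_lt (show (1 / 2 : ℝ) < 1 by norm_num),
    hε.eventually_lt_const (show (1 : ℝ) < 2 by norm_num),
    eventually_mul_rpow_neg_le 2 (p := -δ) (by linarith) (show (0 : ℝ) < 1 / 2 by norm_num),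
    eventually_gt_atTop 0] with n h1 h2 h3 h4
  have h0 : (0 : ℝ) < n := by exact_mod_cast h4
  have hp := Real.rpow_pos_of_pos h0 (-δ)
  rw [lt_div_iff₀ hp] at h1
  rw [div_lt_iff₀ hp] at h2
  exact ⟨by linarith, h2.le, by linarith, by linarith⟩

theorem tendsto_shift_div_sqrt_log {r : ℝ} (hr : 0 < r) {d : ℕ → ℝ}
    (hd : Tendsto (fun n : ℕ => d n / √(2 * r * Real.log n)) atTop (𝓝 1)) :
    Tendsto (fun n : ℕ => d n / √(2 * Real.log n)) atTop (𝓝 (√r)) := by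
  have h := hd.mul_const (√r)
  rw [one_mul] at h
  refine h.congr fun n => ?_
  have : √(2 * r * Real.log n) = √r * √(2 * Real.log n) := by
    rw [← Real.sqrt_mul hr.le]; congr 1; ring
  rw [this]
  have := Real.sqrt_pos.2 hr
  field_simp

theorem tendsto_const_mul_sub_div_sqrt_log {d : ℕ → ℝ} {l : ℝ} (c : ℝ)
    (hd : Tendsto (fun n : ℕ => d n / √(2 * Real.log n)) atTop (𝓝 l)) :
    Tendsto (fun n : ℕ => (c * √(2 * Real.log n) - d n) / √(2 * Real.log n)) atTop
      (𝓝 (c - l)) := by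
  refine (hd.const_sub c).congr' ?_
  filter_upwards [tendsto_sqrt_log_natCast.eventually_gt_atTop 0] with n hn
  field_simp

/-- Detection by the range of the sample: the regime where `√r + √(1 - δ) > 1`. -/
theorem eventually_error_le_of_one_lt {α β δ r : ℝ} (hα : α ∈ Set.Ioo (0 : ℝ) 1) (hβ : 0 < β)
    (hδ : δ ∈ Set.Ioo (0 : ℝ) 1) (hr : r ∈ Set.Ioo (0 : ℝ) 1)
    (hrδ : 1 < √r + √(1 - δ)) {ε μ₁ μ₂ : ℕ → ℝ}
    (hε : Tendsto (fun n : ℕ => ε n / (n : ℝ) ^ (-δ)) atTop (𝓝 1))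
    (hμ : Tendsto (fun n : ℕ => (μ₂ n - μ₁ n) / √(2 * Real.log n)) atTop (𝓝 (√r))) :
    ∀ᶠ n : ℕ in atTop,
      sampleLaw n (mixtureDensity gaussianDensity (ε n) (μ₁ n) (μ₂ n))
        {x | orderTest gaussianDensity n α x = 0} ≤ ENNReal.ofReal β := by
  have hr1 : √r < 1 := by rw [Real.sqrt_lt' one_pos]; linarith [hr.2]
  have hδ1 : √(1 - δ) < 1 := by rw [Real.sqrt_lt' one_pos]; linarith [hδ.1]
  -- With a = (1 + η)s, b = (1 + 3η)s and c = (1 - η)s one has 2a = b + c. The quarter makes 1 + 3η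
  -- - √r = √(1 - δ) - η, so contaminated points still pass μ₁ + b in polynomial number.
  obtain ⟨η, hη⟩ : ∃ η, η = (√r + √(1 - δ) - 1) / 4 := ⟨_, rfl⟩
  have hη0 : 0 < η := by linarith
  have hη1 : η < 1 := by linarith
  have hl : 0 ≤ 1 + 3 * η - √r := by linarith
  obtain ⟨κ, hκ1, hκ2⟩ : ∃ κ, (1 + 3 * η - √r) ^ 2 < κ ∧ κ < 1 - δ :=
    exists_between ((Real.lt_sqrt hl).1 (by linarith))
  obtain ⟨κ', hκ1', hκ2'⟩ : ∃ κ', (1 - η) ^ 2 < κ' ∧ κ' < 1 :=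
    exists_between (by nlinarith)
  obtain ⟨γ, hγ0, hγ⟩ : ∃ γ, 0 < γ ∧ γ < min (1 - δ - κ) (1 - κ') :=
    exists_between (lt_min (by linarith) (by linarith))
  rw [lt_min_iff] at hγ
  have hc := eventually_rpow_neg_le_gaussTail (y := fun n => (1 - η) * √(2 * Real.log n) - 0)
    (l := 1 - η - 0) (κ := κ') (by linarith) (by simpa using hκ1')
    (tendsto_const_mul_sub_div_sqrt_log (d := fun _ => 0) (1 - η) (by simp))
  have hb := eventually_rpow_neg_le_gaussTail hl hκ1
    (tendsto_const_mul_sub_div_sqrt_log (1 + 3 * η) hμ)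
  have hneg : 1 - (1 + η) ^ 2 < 0 := by nlinarith
  filter_upwards [hc, hb, eventually_sparsity_bounds hδ.1 hε, eventually_ge_atTop 2,
    eventually_mul_rpow_neg_le 1 hneg (show (0 : ℝ) < 1 / 2 by norm_num),
    eventually_mul_rpow_neg_le_div_card 8 hneg hα.1,
    eventually_mul_rpow_le 4 hγ.1, eventually_mul_rpow_le 4 hγ.2,
    eventually_mul_rpow_neg_le 4 (neg_neg_of_pos hγ0) hβ]
    with n hc hb ⟨hε1, hε2, hε3⟩ hn hm hmα hγb hγc hγβ
  have h1 : (1 : ℝ) ≤ n := by exact_mod_cast (by omega : 1 ≤ n)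
  have h0 : (0 : ℝ) < n := by linarith
  have hM1 : (1 : ℝ) ≤ (n : ℝ) ^ γ := Real.one_le_rpow h1 hγ0.le
  have hmpos : 0 < (n : ℝ) ^ (1 - (1 + η) ^ 2) := Real.rpow_pos_of_pos h0 _
  have eb : (n : ℝ) ^ (1 - δ - κ) = n * ((n : ℝ) ^ (-δ) * (n : ℝ) ^ (-κ)) := by
    rw [← Real.rpow_add h0, ← Real.rpow_one_add' h0.le (by linarith)]; ring_nf
  have ec : (n : ℝ) ^ (1 - κ') = n * (n : ℝ) ^ (-κ') := by
    rw [← Real.rpow_one_add' h0.le (by linarith)]; ring_nf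
  rw [sub_zero] at hc
  refine sampleLaw_orderTest_eq_zero_le (k := 1) (a := (1 + η) * √(2 * Real.log n))
    (b := (1 + 3 * η) * √(2 * Real.log n)) (c := (1 - η) * √(2 * Real.log n))
    (m := (n : ℝ) ^ (1 - (1 + η) ^ 2)) (M := (n : ℝ) ^ γ) hn (one_mem_indexSet hn) hα
    ⟨hε3.1, by linarith [hε3.2]⟩ (by linarith) ?_ ?_ ?_ (by linarith) ?_ ?_ ?_
  · refine (mul_le_mul_of_nonneg_left (gaussTail_mul_sqrt_log_le (by omega : 1 ≤ n)
      (by linarith : 0 ≤ 1 + η)) h0.le).trans_eq ?_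
    rw [← Real.rpow_one_add' h0.le (by nlinarith)]; ring_nf
  · push_cast; linarith
  · refine le_trans ?_ hmα
    have h4 : (1 / 2 : ℝ) ^ 2 ≤ (1 - (n : ℝ) ^ (1 - (1 + η) ^ 2)) ^ 2 := by
      gcongr
      linarith
    rw [Nat.cast_one, mul_div_assoc', div_le_iff₀ (by linarith)]
    have := mul_le_mul_of_nonneg_left h4 hmpos.le
    linarith
  · have h2 : 0 ≤ (1 - ε n) * gaussTail ((1 + 3 * η) * √(2 * Real.log n)) :=
      mul_nonneg (by linarith [hε3.2]) (gaussTail_nonneg _)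
    have h3 : (n : ℝ) ^ (-δ) / 2 * (n : ℝ) ^ (-κ) ≤
        ε n * gaussTail ((1 + 3 * η) * √(2 * Real.log n) - (μ₂ n - μ₁ n)) := by
      gcongr
      exact hε3.1
    have h4 := mul_le_mul_of_nonneg_left (add_le_add h2 h3) h0.le
    push_cast
    linarith
  · have h3 : (1 / 2 : ℝ) * (n : ℝ) ^ (-κ') ≤
        (1 - ε n) * gaussTail ((1 - η) * √(2 * Real.log n)) := by
      refine mul_le_mul ?_ hc (by positivity) ?_ <;> linarith [hε3.2]
    have h4 := mul_le_mul_of_nonneg_left h3 h0.le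
    push_cast
    linarith
  · refine le_trans ?_ hγβ
    rw [Real.rpow_neg h0.le, Nat.cast_one, mul_div_assoc', div_le_iff₀ (by positivity),
      sq, ← mul_assoc, mul_assoc 4, inv_mul_cancel₀ (by positivity)]
    linarith

/-- Detection by intermediate spacings: the regime where `δ - 1/2 < r < 1/4`. -/
theorem eventually_error_le_of_lt_quarter {α β δ r : ℝ} (hα : α ∈ Set.Ioo (0 : ℝ) 1)
    (hβ : 0 < β) (hδ : δ ∈ Set.Ioo (1 / 2 : ℝ) 1) (hr : r ∈ Set.Ioo (0 : ℝ) (1 / 4))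
    (hrδ : δ - 1 / 2 < r) {ε μ₁ μ₂ : ℕ → ℝ}
    (hε : Tendsto (fun n : ℕ => ε n / (n : ℝ) ^ (-δ)) atTop (𝓝 1))
    (hμ : Tendsto (fun n : ℕ => (μ₂ n - μ₁ n) / √(2 * Real.log n)) atTop (𝓝 (√r))) :
    ∀ᶠ n : ℕ in atTop,
      sampleLaw n (mixtureDensity gaussianDensity (ε n) (μ₁ n) (μ₂ n))
        {x | orderTest gaussianDensity n α x = 0} ≤ ENNReal.ofReal β := by
  obtain ⟨hδ0, hδ1⟩ := hδ
  obtain ⟨hr0, hr1⟩ := hr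
  -- The margin M = n^γ must exceed the fluctuation √k ≈ n^{1/2-2r} yet stay below the contaminated
  -- count n^{1-δ-r} and below k itself. The two upper bounds leave room exactly when δ - 1/2 < r
  -- and r < 1/4.
  obtain ⟨γ, hγ0, hγ⟩ : ∃ γ, 1 / 2 - 2 * r < γ ∧ γ < min (1 - δ - r) (1 - 4 * r) :=
    exists_between (lt_min (by linarith) (by linarith))
  rw [lt_min_iff] at hγ
  obtain ⟨κ, hκ1, hκ2⟩ : ∃ κ, r < κ ∧ κ < 1 - δ - γ := exists_between (by linarith)
  have hs0 : 0 < √r := Real.sqrt_pos.2 hr0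
  have hs2 : √r ^ 2 = r := Real.sq_sqrt hr0.le
  obtain ⟨y, hy1, hy2⟩ : ∃ y, √r < y ∧ y < √κ :=
    exists_between (Real.sqrt_lt_sqrt hr0.le hκ1)
  have hyκ : y ^ 2 < κ := (Real.lt_sqrt (by linarith)).1 hy2
  have hyr : 4 * r < (y + √r) ^ 2 := by nlinarith
  have hb := eventually_rpow_neg_le_gaussTail (l := y + √r - √r) (by linarith)
    (by simpa using hyκ) (tendsto_const_mul_sub_div_sqrt_log (y + √r) hμ)
  have hneg : 1 - 4 * r - 2 * γ < 0 := by linarith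
  have hφ : 0 < gaussianDensity 1 := by unfold gaussianDensity; positivity
  filter_upwards [hb, eventually_sparsity_bounds (by linarith) hε, eventually_ge_atTop 2,
    eventually_mul_rpow_neg_le 2 (p := -(4 * r)) (by linarith) (lt_min hφ one_pos),
    eventually_mul_rpow_neg_le_div_card 2 hneg hα.1,
    eventually_mul_rpow_neg_le 4 hneg hβ,
    eventually_mul_rpow_le 16 hγ.2,
    eventually_mul_rpow_le 4 (show 1 - 4 * r - δ < γ by linarith),
    eventually_mul_rpow_le 8 (show 1 - (y + √r) ^ 2 < 1 - 4 * r by linarith),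
    eventually_mul_rpow_le 12 (show γ < 1 - δ - κ by linarith)]
    with n hb ⟨hε1, hε2, hε3⟩ hn hsmall hmα hmβ hγk hγε hyk hγb
  have h1 : (1 : ℝ) ≤ n := by exact_mod_cast (by omega : 1 ≤ n)
  have h0 : (0 : ℝ) < n := by linarith
  have hM : 0 < (n : ℝ) ^ γ := Real.rpow_pos_of_pos h0 _
  have hR1 : 1 ≤ (n : ℝ) ^ (1 - 4 * r) := Real.one_le_rpow h1 (by linarith)
  have eR : (n : ℝ) ^ (1 - 4 * r) = n * (n : ℝ) ^ (-(4 * r)) := by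
    rw [← Real.rpow_one_add' h0.le (by linarith)]; ring_nf
  have eε : (n : ℝ) ^ (1 - 4 * r - δ) = (n : ℝ) ^ (1 - 4 * r) * (n : ℝ) ^ (-δ) := by
    rw [← Real.rpow_add h0]; ring_nf
  have eM : (n : ℝ) ^ (1 - 4 * r - 2 * γ) = (n : ℝ) ^ (1 - 4 * r) / ((n : ℝ) ^ γ) ^ 2 := by
    rw [Real.rpow_sub h0, ← Real.rpow_natCast ((n : ℝ) ^ γ), ← Real.rpow_mul h0.le]
    ring_nf
  have ey : (n : ℝ) ^ (1 - (y + √r) ^ 2) = n * (n : ℝ) ^ (-(y + √r) ^ 2) := by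
    rw [sub_eq_add_neg, Real.rpow_add h0, Real.rpow_one]
  have eb : (n : ℝ) ^ (1 - δ - κ) = n * ((n : ℝ) ^ (-δ) * (n : ℝ) ^ (-κ)) := by
    rw [← Real.rpow_add h0, ← Real.rpow_one_add' h0.le (by linarith)]; ring_nf
  set M := (n : ℝ) ^ γ
  set R := (n : ℝ) ^ (1 - 4 * r)
  -- Rounding to a power of 2 costs a factor 2 at most.
  obtain ⟨j, hjR, hRj⟩ : ∃ j : ℕ, ((2 ^ j : ℕ) : ℝ) ≤ R ∧ R < 2 * ((2 ^ j : ℕ) : ℝ) := by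
    have hfl : ⌊R⌋₊ ≠ 0 := (Nat.floor_pos.2 hR1).ne'
    refine ⟨Nat.log 2 ⌊R⌋₊, (Nat.cast_le.2 (Nat.pow_log_le_self 2 hfl)).trans
      (Nat.floor_le (by linarith)), (Nat.lt_floor_add_one R).trans_le ?_⟩
    have := Nat.lt_pow_succ_log_self one_lt_two ⌊R⌋₊
    rw [pow_succ] at this
    exact_mod_cast (by omega : ⌊R⌋₊ + 1 ≤ 2 * 2 ^ Nat.log 2 ⌊R⌋₊)
  have hsmall1 : 2 * R ≤ n * gaussianDensity 1 := by
    rw [eR]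
    calc 2 * (n * (n : ℝ) ^ (-(4 * r))) = n * (2 * (n : ℝ) ^ (-(4 * r))) := by ring
      _ ≤ n * gaussianDensity 1 := by gcongr; exact hsmall.trans (min_le_left _ _)
  have hsmall2 : 2 * R ≤ n := by
    rw [eR]
    calc 2 * (n * (n : ℝ) ^ (-(4 * r))) = n * (2 * (n : ℝ) ^ (-(4 * r))) := by ring
      _ ≤ n * 1 := by gcongr; exact hsmall.trans (min_le_right _ _)
      _ = n := mul_one _
  have hk : 2 ^ j ∈ indexSet n := by
    refine two_pow_mem_indexSet hn ?_
    have : (2 : ℝ) * ((2 ^ j : ℕ) : ℝ) ≤ n := by linarith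
    exact_mod_cast this
  set k : ℝ := ((2 ^ j : ℕ) : ℝ) with hkdef
  -- The thresholds are defined by their expected counts, k - M at `a` and k + 2M at `c`; with b =
  -- 2a - c, convexity leaves at least k - 4M points at `b`.
  obtain ⟨a, ha0, ha⟩ := exists_gaussTail_eq (p := (k - M) / n)
    (div_pos (by linarith) h0) (by rw [div_le_iff₀ h0]; linarith)
  obtain ⟨c, hc0, hc⟩ := exists_gaussTail_eq (p := (k + 2 * M) / n)
    (div_pos (by linarith) h0) (by rw [div_le_iff₀ h0]; linarith)
  rw [eq_div_iff h0.ne', mul_comm] at ha hc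
  have hca : c < a := gaussTail_antitone.reflect_lt (by
    refine lt_of_mul_lt_mul_left (a := (n : ℝ)) ?_ h0.le
    linarith)
  have hconv := two_mul_gaussTail_le (a := a) (h := a - c) (by linarith) (by linarith)
  rw [sub_sub_cancel] at hconv
  set b := a + (a - c) with hbdef
  have hTb : k - 4 * M ≤ n * gaussTail b := by
    have := mul_le_mul_of_nonneg_left hconv h0.le
    linarith
  have hTb' : n * gaussTail b ≤ k := by
    have := mul_le_mul_of_nonneg_left
      (gaussTail_antitone (show a ≤ b by linarith)) h0.le
    linarith
  -- Since (y + √r)² > 4r, the expected count at (y + √r)s is at most R/8, whereas at `b` it is at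
  -- least k - 4M > R/4.
  have hby : b < (y + √r) * √(2 * Real.log n) := gaussTail_antitone.reflect_lt (by
    refine lt_of_mul_lt_mul_left (a := (n : ℝ)) ?_ h0.le
    have := mul_le_mul_of_nonneg_left (gaussTail_mul_sqrt_log_le (by omega : 1 ≤ n)
      (by linarith : 0 ≤ y + √r)) h0.le
    linarith)
  have hTd : (n : ℝ) ^ (-κ) ≤ gaussTail (b - (μ₂ n - μ₁ n)) :=
    hb.trans (gaussTail_antitone (by linarith))
  have hεR : ε n * (2 * R) ≤ M := by
    have : ε n * (2 * R) ≤ 2 * (n : ℝ) ^ (-δ) * (2 * R) := by gcongr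
    linarith
  have hεk : ε n * (k + 2 * M) ≤ M :=
    le_trans (mul_le_mul_of_nonneg_left (by linarith) hε3.1) hεR
  refine sampleLaw_orderTest_eq_zero_le (a := a) (b := b) (c := c) (m := k - M) (M := M) hn hk
    hα ⟨hε3.1, by linarith [hε3.2]⟩ (by linarith) ha.le (by linarith) ?_ hM ?_ ?_ ?_
  · refine le_trans ?_ hmα
    rw [← hkdef, sub_sub_cancel, eM]
    gcongr
    linarith
  · have h2 : ε n * (n * gaussTail b) ≤ M :=
      le_trans (mul_le_mul_of_nonneg_left (by linarith) hε3.1) hεR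
    have h3 : (n : ℝ) ^ (-δ) / 2 * (n : ℝ) ^ (-κ) ≤
        ε n * gaussTail (b - (μ₂ n - μ₁ n)) := by
      gcongr
      exact hε3.1
    have h4 := mul_le_mul_of_nonneg_left h3 h0.le
    -- Budget: at least k - 4M null points, at most M lost to the factor 1 - ε, and at least 6M
    -- contaminated points gained.
    calc k + M ≤ n * gaussTail b - ε n * (n * gaussTail b) +
          n * ((n : ℝ) ^ (-δ) / 2 * (n : ℝ) ^ (-κ)) := by linarith
      _ ≤ n * gaussTail b - ε n * (n * gaussTail b) +
          n * (ε n * gaussTail (b - (μ₂ n - μ₁ n))) := by linarith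
      _ = _ := by ring
  · have : n * ((1 - ε n) * gaussTail c) = (k + 2 * M) - ε n * (k + 2 * M) := by
      rw [← hc]; ring
    linarith
  · refine le_trans ?_ hmβ
    rw [← hkdef, eM, mul_div_assoc', mul_div_assoc']
    exact div_le_div_of_nonneg_right (by linarith) (by positivity)

/-- For δ ≥ 3/4 the boundary is the curve √r + √(1 - δ) = 1 itself. For δ < 3/4, √(1 - δ) > 1/2, so
failure of the first alternative forces √r < 1/2. -/
theorem one_lt_sqrt_add_sqrt_or {δ r : ℝ} (hr : 0 < r)
    (hrδ : sparseBoundary δ < r) :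
    1 < √r + √(1 - δ) ∨ (r < 1 / 4 ∧ δ - 1 / 2 < r) := by
  rcases lt_or_ge 1 (√r + √(1 - δ)) with h | h
  · exact Or.inl h
  right
  have hr2 : √r ^ 2 = r := Real.sq_sqrt hr.le
  have hr0 : 0 < √r := Real.sqrt_pos.2 hr
  unfold sparseBoundary at hrδ
  split_ifs at hrδ with hδ'
  · have : 1 / 2 < √(1 - δ) := Real.lt_sqrt_of_sq_lt (by linarith)
    exact ⟨by nlinarith, hrδ⟩
  · nlinarith

theorem mainTheorem5 (α β δ r : ℝ) (hα : α ∈ Set.Ioo (0 : ℝ) 1) (hβ : β ∈ Set.Ioo (0 : ℝ) 1)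
    (hδ : δ ∈ Set.Ioo (1 / 2 : ℝ) 1) (hr : r ∈ Set.Ioo (0 : ℝ) 1) (hrδ : sparseBoundary δ < r)
    (ε μ₁ μ₂ : ℕ → ℝ)
    (hε : Tendsto (fun n : ℕ => ε n / (n : ℝ) ^ (-δ)) atTop (𝓝 1))
    (hμ : Tendsto (fun n : ℕ => (μ₂ n - μ₁ n) / Real.sqrt (2 * r * Real.log n)) atTop (𝓝 1)) :
    (∀ n : ℕ, 2 ≤ n → IsLevelTest gaussianDensity n α (orderTest gaussianDensity n α)) ∧
      ∀ᶠ n : ℕ in atTop,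
        sampleLaw n (mixtureDensity gaussianDensity (ε n) (μ₁ n) (μ₂ n))
          {x | orderTest gaussianDensity n α x = 0} ≤ ENNReal.ofReal β := by
  refine ⟨fun n hn => isLevelTest_orderTest hn hα, ?_⟩
  have hμ' := tendsto_shift_div_sqrt_log hr.1 hμ
  rcases one_lt_sqrt_add_sqrt_or hr.1 hrδ with h | h
  · exact eventually_error_le_of_one_lt hα hβ.1 ⟨by linarith [hδ.1], hδ.2⟩ hr h hε hμ'
  · exact eventually_error_le_of_lt_quarter hα hβ.1 hδ ⟨hr.1, h.1⟩ h.2 hε hμ'
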